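/- **Setting.** All logarithms are to base $2$. A hash function with $n$-bit inputs and $\ell$-bit outputs is a map $h:\{1,\dots,2^n\}\to\{0,1\}^\ell$; its outputs are called bins. A keyed family is a bijection $f$ from the keys $k\in\{0,1\}^{\ell 2^n}$ onto the set of all such functions; the size of its key is $\ell 2^n$. In the segmented family the key is cut into $2^n$ consecutive segments $k_1,\dots,k_{2^n}$ of $\ell$ bits, and input $i$ is mapped to $k_i$. The key bits are i.i.d. Bernoulli$(p)$ ($1$ has probability $p$); the key is uniform if $p=1/2$. There are $M\le 2^\ell$ users. They are allocated different bins $b_1,\dots,b_M$ in order of likelihood: $b_1$ is a least likely bin, $b_2$ a second least likely one, etc., where the likelihood of a bin is that of $\ell$ i.i.d. Bernoulli$(p)$ bits (ties are broken arbitrarily). The attacker fixes for each user an order in which he guesses all the inputs. The guesswork of a bin is the number of guesses until the first input that is mapped to it, and $0$ if there is no such input. The allocation is implemented in one of two ways. *Direct:* the password of user $j$ is some input that is mapped to $b_j$, and the guesswork of user $j$ is that of $b_j$. *Backdoor:* the users draw passwords independently and uniformly from the inputs, each drawn password is re-mapped to the bin of the first user in the above list who drew it, and the guesswork of a user is that of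 the bin to which his password is now mapped, under the modified function. The average guesswork is the mean over a uniformly chosen user, over the key and, in the backdoor case, over the passwords. A family with a Bernoulli$(p)$ key *achieves* average guesswork $g$ for $M$ users if $M\le 2^\ell$ and its average guesswork is at least $g$ for all guessing orders and all ways of breaking ties. Let $D(q\|p)=q\log\frac qp+(1-q)\log\frac{1-q}{1-p}$. **Theorem.** Let $\alpha>1$. There is exactly one $p_0\in(0,1/2]$ with $1+D(1/2\|p_0)=\alpha$. Let $n(m)$, $m\ge1$, be natural numbers with $(n(m)-\alpha m)/\log m\to\infty$ (for example $n(m)=\lceil(1+\varepsilon)\alpha m\rceil$ with $\varepsilon>0$). For each $m$, let there be $M=2^{m-1}$ users, $n(m)$-bit inputs, and target average guesswork $2^{\alpha m}$. For each $m$ and each output length $\ell$ let $f_{m,\ell}$ be any bijection from the keys onto the hash functions with $n(m)$-bit inputs and $\ell$-bit outputs. Choose for the uniform key, and independently for the biased key, either of the two ways of implementing the allocation. Then: 1. For all large $m$ there are a least output length $u(m)$ for which the family $f_{m,u(m)}$ with a uniform key achieves $2^{\alpha m}$, and a least output length $v(m)$ for which the segmented family with an i.i.d. Bernoulli$(p_0)$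 key achieves $2^{\alpha m}$. Moreover, for all large $m$, the segmented family with output length $m$ and an i.i.d. Bernoulli$(p_0)$ key, of size $m2^{n(m)}$, achieves $2^{\alpha m}$. 2. The uniform key is asymptotically $\alpha$ times longer than the biased key: $$\lim_{m\to\infty}\frac{u(m)\,2^{n(m)}}{m\,2^{n(m)}}=\alpha\qquad\text{and}\qquad \lim_{m\to\infty}\frac{u(m)\,2^{n(m)}}{v(m)\,2^{n(m)}}=\alpha .$$ 3. The average guesswork $E_m$ of the family $f_{m,u(m)}$ with a uniform key satisfies $\frac1m\log E_m\to\alpha$ for all guessing orders and ways of breaking ties. If $n(m)/m\to\alpha$, the same holds for the segmented family with output length $m$ and an i.i.d. Bernoulli$(p_0)$ key. -/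

import Mathlib

open Filter Topology

namespace KeyedHash

/-- The Kullback-Leibler divergence `D(q || p)`, in bits, between Bernoulli laws. -/
noncomputable def binaryKL (q p : ℝ) : ℝ :=
  q * Real.logb 2 (q / p) + (1 - q) * Real.logb 2 ((1 - q) / (1 - p))

/-- The `2 ^ n` inputs (passwords) of `n` bits, numbered `0, …, 2 ^ n - 1`. -/
abbrev Input (n : ℕ) : Type := Fin (2 ^ n)

/-- A bin: an output of `m` bits. -/
abbrev Bin (m : ℕ) : Type := Fin m → Bool

/-- A hash function from `n` bits to `m` bits. -/
abbrev HashFn (n m : ℕ) : Type := Input n → Bin m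

/-- The number of bits of the key of a hash family with `n`-bit inputs and `m`-bit outputs. -/
def keyLength (n m : ℕ) : ℕ := 2 ^ n * m

/-- A key: a string of `2 ^ n * m` bits. -/
abbrev Key (n m : ℕ) : Type := Fin (keyLength n m) → Bool

/-- The segmented family: the key is cut into `2 ^ n` consecutive segments of `m` bits, and
the hash value of the input `i` is the `i`-th segment (`finProdFinEquiv (i, j) = j + m * i`). -/
def segmented (n m : ℕ) : Key n m ≃ HashFn n m :=
  (Equiv.arrowCongr (finProdFinEquiv (m := 2 ^ n) (n := m)).symm (Equiv.refl Bool)).trans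
    (Equiv.curry (Input n) (Fin m) Bool)

/-- The probability of the bit string `v` when its bits are i.i.d. Bernoulli(`p`). -/
noncomputable def bernoulliMass {L : ℕ} (p : ℝ) (v : Fin L → Bool) : ℝ :=
  ∏ i, if v i then p else 1 - p

/-- Bins are allocated to `M` users in order of likelihood: user `0` gets a least likely bin,
user `1` a second least likely one, and so on, the likelihood of a bin being that of a
string of i.i.d. Bernoulli(`p`) bits. Ties are broken arbitrarily. -/
structure IsLeastLikely {M m : ℕ} (p : ℝ) (b : Fin M → Bin m) : Prop where
  injective : Function.Injective b
  monotone : Monotone fun j => bernoulliMass p (b j)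
  least : ∀ c, c ∉ Set.range b → ∀ j, bernoulliMass p (b j) ≤ bernoulliMass p c

/-- The number of guesses that the guessing order `σ` (first `σ 0`, then `σ 1`, …) needs to hit
an input which `h` maps to the bin `c`. It is `0 = sInf ∅` if there is no such input. -/
noncomputable def guesswork {n m : ℕ} (h : HashFn n m) (σ : Equiv.Perm (Input n))
    (c : Bin m) : ℕ :=
  sInf {t | ∃ l : Input n, h (σ l) = c ∧ t = (l : ℕ) + 1}

/-- The hash function after planting: each input which is the password of some user is mapped
to the bin allocated to the first (so the least likely allocated) of the users with this
password; all other inputs keep their hash value. -/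
def planted {n m M : ℕ} (h : HashFn n m) (b : Fin M → Bin m) (w : Fin M → Input n) :
    HashFn n m := fun x =>
  if hx : (Finset.univ.filter fun j => w j = x).Nonempty then
    b ((Finset.univ.filter fun j => w j = x).min' hx)
  else h x

/-- The two ways to implement the bin allocation. -/
inductive Allocation : Type
  /-- Each user gets, as a password, some input which the hash function maps to his bin; there
  are no guesses to be made for a bin to which nothing is mapped. -/
  | direct
  /-- The backdoor: the users draw passwords independently and uniformly, and the mappings from
  the passwords to the allocated bins are planted in the hash function. -/
  | backdoor

/-- The guesswork averaged over the `M` users, for a hash function `h`, allocated bins `b`, and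
an attacker who uses the order `σ j` against user `j`. In the backdoor case it is also
averaged over the passwords `w`, and the bin of user `j` is the one to which his password
is mapped after planting. -/
noncomputable def usersGuesswork {n m M : ℕ} (h : HashFn n m) (b : Fin M → Bin m)
    (σ : Fin M → Equiv.Perm (Input n)) : Allocation → ℝ
  | .direct => (∑ j, (guesswork h (σ j) (b j) : ℝ)) / M
  | .backdoor => (∑ w : Fin M → Input n,
      (∑ j, (guesswork (planted h b w) (σ j) (planted h b w (w j)) : ℝ)) / M) /
        (2 ^ n : ℝ) ^ M

/-- The average guesswork: the expectation of `usersGuesswork` when the bits of the key are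
i.i.d. Bernoulli(`p`) and the key `k` selects the hash function `f k`. -/
noncomputable def averageGuesswork {n m M : ℕ} (A : Allocation) (p : ℝ)
    (f : Key n m ≃ HashFn n m) (b : Fin M → Bin m) (σ : Fin M → Equiv.Perm (Input n)) : ℝ :=
  ∑ k : Key n m, bernoulliMass p k * usersGuesswork (f k) b σ A

/-- With an i.i.d. Bernoulli(`p`) key, the family `f` has enough bins for `M` users and achieves
average guesswork at least `g` against all guessing strategies (whatever the way in which
ties are broken in the bin allocation). -/
def Achieves {n m : ℕ} (A : Allocation) (p : ℝ) (f : Key n m ≃ HashFn n m) (M : ℕ) (g : ℝ) :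
    Prop :=
  M ≤ 2 ^ m ∧ ∀ (b : Fin M → Bin m) (σ : Fin M → Equiv.Perm (Input n)),
    IsLeastLikely p b → g ≤ averageGuesswork A p f b σ

end KeyedHash

open KeyedHash

namespace KeyedHash

/-! ### Product measures -/

section Product

variable {ι κ : Type*} [Fintype ι] [DecidableEq ι] [Fintype κ] {μ : κ → ℝ}

/-! For both kinds of key the hash values are i.i.d. with the Bernoulli law on bins
(`sum_key_eq_sum_hash`). Hence a bin of mass `q` is missed by `t` fixed guesses with probability `(1
- q) ^ t`, in whatever order they are made. With `N = 2 ^ n` inputs, summing these tails gives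
expected guesswork about `1 / q`, up to a factor `1 - 2 / (N * q)`. Planting passwords preserves
this lower bound and adds at most `M` to the upper bound `1 / q` (`le_averageGuesswork`,
`averageGuesswork_half_le`).

Uniform key: every bin has `q = 2 ^ (-l)` and `M ≤ 2 ^ l`, so the average guesswork is `2 ^ l` up to
a factor 2 in either direction, and the least `l` is `α * m + O(1)`.

Biased key: `1 + D(1/2‖p) = α` says that `√(p (1 - p)) = 2 ^ (-α)`, so a bin with about `m / 2` ones
has mass about `2 ^ (-α m)`. The `2 ^ (m - 1)` least likely bins include all those with more than `m
/ 2` ones (`mem_range_of_lt_weight`). One layer at the middle would lose a factor of order `m`,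
because it holds only that share of the bins. The layer `k ≈ C log m` above the middle repairs this:
`1 / q` gains `r ^ k` with `r = (1 - p) / p > 1`, while the binomial coefficient loses only `ρ ^ k`
with `ρ * r > 1` (`pow_mul_choose_middle_le`). The condition that `N * q` stay bounded below is what
`(n - α m) / log m → ∞` provides. So length `m` suffices, and `m - 1` is necessary to have enough
bins.

The mean of `1 / q` over users has rate `2α - 1 > α`, so the upper bound for the biased key comes
from the trivial bound `2 ^ n` instead. -/

theorem sum_prod_mul_prod (μ : κ → ℝ) (g : ι → κ → ℝ) :
    ∑ h : ι → κ, (∏ i, μ (h i)) * ∏ i, g i (h i) = ∏ i, ∑ c, μ c * g i c := by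
  rw [Finset.prod_univ_sum, Fintype.piFinset_univ]
  exact Finset.sum_congr rfl fun h _ => Finset.prod_mul_distrib.symm

theorem sum_prod_eq_one (hμ : ∑ c, μ c = 1) : ∑ h : ι → κ, ∏ i, μ (h i) = 1 := by
  simpa [hμ] using sum_prod_mul_prod (ι := ι) μ fun _ _ => 1

theorem sum_prod_mul_eval (hμ : ∑ c, μ c = 1) (j : ι) (g : κ → ℝ) :
    ∑ h : ι → κ, (∏ i, μ (h i)) * g (h j) = ∑ c, μ c * g c := by
  have key := sum_prod_mul_prod μ fun i c => if i = j then g c else 1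
  simp only [Finset.prod_ite_eq', Finset.mem_univ, if_true] at key
  rw [key, Finset.prod_eq_single j]
  · simp
  · intro i _ hi
    simp [hi, hμ]
  · simp

/-- Independence: the indicator of avoiding `c` on `S` is a product of one factor per coordinate. -/
theorem sum_prod_mul_avoid [DecidableEq κ] (hμ : ∑ c, μ c = 1) (S : Finset ι) (c : κ) :
    ∑ h : ι → κ, (∏ i, μ (h i)) * (if ∀ x ∈ S, h x ≠ c then 1 else 0) =
      (1 - μ c) ^ S.card := by
  have key := sum_prod_mul_prod μ fun i d => if i ∈ S ∧ d = c then (0 : ℝ) else 1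
  have hind : ∀ h : ι → κ, (if ∀ x ∈ S, h x ≠ c then (1 : ℝ) else 0) =
      ∏ i, if i ∈ S ∧ h i = c then (0 : ℝ) else 1 := by
    intro h
    split_ifs with hh
    · exact (Finset.prod_eq_one fun i _ => if_neg fun hi => hh i hi.1 hi.2).symm
    · push Not at hh
      obtain ⟨x, hx, hc⟩ := hh
      exact (Finset.prod_eq_zero (Finset.mem_univ x) (by simp [hx, hc])).symm
  simp only [hind, key]
  have hfac : ∀ i, ∑ d, μ d * (if i ∈ S ∧ d = c then (0 : ℝ) else 1) =
      if i ∈ S then 1 - μ c else 1 := by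
    intro i
    by_cases hi : i ∈ S
    · have : ∀ d, μ d * (if i ∈ S ∧ d = c then (0 : ℝ) else 1) =
          μ d - if d = c then μ d else 0 := by
        intro d
        by_cases hd : d = c <;> simp [hi, hd]
      rw [Finset.sum_congr rfl fun d _ => this d, Finset.sum_sub_distrib, hμ]
      simp [hi]
    · simp [hi, hμ]
  simp only [hfac]
  rw [Finset.prod_ite]
  simp

end Product

theorem bernoulliMass_pos {L : ℕ} {p : ℝ} (h0 : 0 < p) (h1 : p < 1) (v : Fin L → Bool) :
    0 < bernoulliMass p v :=
  Finset.prod_pos fun i _ => by split_ifs <;> linarith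

theorem sum_bernoulliMass {L : ℕ} (p : ℝ) : ∑ v : Fin L → Bool, bernoulliMass p v = 1 :=
  sum_prod_eq_one (μ := fun b : Bool => if b then p else 1 - p) (by simp)

theorem bernoulliMass_le_one {L : ℕ} {p : ℝ} (h0 : 0 < p) (h1 : p < 1) (v : Fin L → Bool) :
    bernoulliMass p v ≤ 1 :=
  Finset.prod_le_one (fun i _ => by split_ifs <;> linarith)
    fun i _ => by split_ifs <;> linarith

theorem bernoulliMass_half {L : ℕ} (v : Fin L → Bool) :
    bernoulliMass (1 / 2) v = (1 / 2) ^ L := by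
  have : ∀ i, (if v i then (1 / 2 : ℝ) else 1 - 1 / 2) = 1 / 2 := fun i => by
    split_ifs <;> norm_num
  simp only [bernoulliMass, this, Finset.prod_const, Finset.card_univ, Fintype.card_fin]

/-- Under a uniform key any family, and under any Bernoulli key the segmented family, yields
hash values which are independent strings of Bernoulli bits. -/
theorem sum_key_eq_sum_hash {n m : ℕ} {p : ℝ} {f : Key n m ≃ HashFn n m}
    (hf : p = 1 / 2 ∨ f = segmented n m) (F : HashFn n m → ℝ) :
    ∑ k, bernoulliMass p k * F (f k) = ∑ h, (∏ i, bernoulliMass p (h i)) * F h := by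
  rw [← f.sum_comp]
  refine Finset.sum_congr rfl fun k _ => ?_
  congr 1
  rcases hf with rfl | rfl
  · simp only [bernoulliMass_half, Finset.prod_const, Finset.card_univ, Fintype.card_fin,
      ← pow_mul, mul_comm m]
    rfl
  · unfold bernoulliMass
    rw [← Fintype.prod_prod_type']
    exact ((finProdFinEquiv (m := 2 ^ n) (n := m)).prod_comp _).symm

/-! ### Guesswork as a sum of tails -/

section Guesswork

variable {n m : ℕ} (h : HashFn n m) (σ : Equiv.Perm (Input n)) (c : Bin m)

theorem guesswork_le : guesswork h σ c ≤ 2 ^ n := by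
  unfold guesswork
  rcases Set.eq_empty_or_nonempty {t | ∃ l : Input n, h (σ l) = c ∧ t = (l : ℕ) + 1} with he | he
  · simp [he]
  · obtain ⟨l, -, hl⟩ := Nat.sInf_mem he
    rw [hl]
    exact l.2

/-- The first `t` inputs in the guessing order `σ`. -/
def guessed (σ : Equiv.Perm (Input n)) (t : ℕ) : Finset (Input n) :=
  Finset.univ.filter fun x => (σ.symm x : ℕ) < t

theorem card_guessed {t : ℕ} (ht : t ≤ 2 ^ n) : (guessed σ t).card = t := by
  have : guessed σ t = (Finset.univ.filter fun x : Input n => (x : ℕ) < t).map σ.toEmbedding := by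
    ext x
    simp [guessed]
  rw [this, Finset.card_map, Fin.card_filter_val_lt, min_eq_right ht]

theorem guessed_full : guessed σ (2 ^ n) = Finset.univ := by
  ext x
  simp [guessed]

/-- A natural number is the sum of the indicators of `t < guesswork`. The subtracted term removes
the functions that miss `c` altogether, whose guesswork is `0` by convention. -/
theorem guesswork_eq_sum : (guesswork h σ c : ℝ) = ∑ t ∈ Finset.range (2 ^ n),
    ((if ∀ x ∈ guessed σ t, h x ≠ c then 1 else 0) -
      if ∀ x ∈ guessed σ (2 ^ n), h x ≠ c then (1 : ℝ) else 0) := by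
  by_cases hc : ∀ x, h x ≠ c
  · have : guesswork h σ c = 0 := by simp [guesswork, hc]
    simp [this, hc]
  · have hne : {t | ∃ l : Input n, h (σ l) = c ∧ t = (l : ℕ) + 1}.Nonempty := by
      push Not at hc
      obtain ⟨x, hx⟩ := hc
      exact ⟨_, σ.symm x, by simpa using hx, rfl⟩
    have hiff : ∀ t, (∀ x ∈ guessed σ t, h x ≠ c) ↔ t < guesswork h σ c := by
      intro t
      constructor
      · intro ht
        obtain ⟨l, hl, hl'⟩ := Nat.sInf_mem hne
        by_contra hcon
        have : (l : ℕ) + 1 ≤ t := by rw [← hl']; exact not_lt.mp hcon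
        exact ht (σ l) (by simp [guessed]; omega) hl
      · intro ht x hx hxc
        have : guesswork h σ c ≤ (σ.symm x : ℕ) + 1 := Nat.sInf_le ⟨σ.symm x, by simpa using hxc, rfl⟩
        simp [guessed] at hx
        omega
    have hle := guesswork_le h σ c
    simp only [hiff, not_lt.mpr hle, if_false, sub_zero]
    rw [Finset.sum_ite, Finset.sum_const_zero, add_zero, Finset.sum_const]
    have : (Finset.range (2 ^ n)).filter (fun t => t < guesswork h σ c) =
        Finset.range (guesswork h σ c) := by
      ext t; simp; omega
    simp [this]

end Guesswork

/-! ### Planted passwords -/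

section Planted

variable {n m M : ℕ} (h : HashFn n m) {b : Fin M → Bin m} (w : Fin M → Input n)

/-- The first user who has the same password as user `j`. -/
def firstUser (j : Fin M) : Fin M :=
  (Finset.univ.filter fun i => w i = w j).min' ⟨j, by simp⟩

theorem firstUser_le (j : Fin M) : firstUser w j ≤ j :=
  Finset.min'_le _ _ (by simp)

theorem password_firstUser (j : Fin M) : w (firstUser w j) = w j := by
  exact (Finset.mem_filter.mp
    (Finset.min'_mem (Finset.univ.filter fun i => w i = w j) ⟨j, by simp⟩)).2

theorem planted_password (b : Fin M → Bin m) (j : Fin M) :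
    planted h b w (w j) = b (firstUser w j) := by
  have : (Finset.univ.filter fun i => w i = w j).Nonempty := ⟨j, by simp⟩
  simp only [planted, this, dif_pos]
  rfl

theorem planted_of_notMem (b : Fin M → Bin m) {x : Input n} (hx : ∀ i, w i ≠ x) :
    planted h b w x = h x := by
  simp [planted, hx]

/-- As bins are distinct, the only planted input lying in the bin of user `j` is his own password.
-/
theorem planted_password_eq_iff (hb : Function.Injective b) (i j : Fin M) :
    planted h b w (w i) = b (firstUser w j) ↔ w i = w j := by
  rw [planted_password, hb.eq_iff]
  constructor
  · intro hij
    exact (password_firstUser w i).symm.trans (hij ▸ password_firstUser w j)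
  · intro hij
    simp only [firstUser, hij]

theorem guesswork_planted_eq_sum (b : Fin M → Bin m) (σ : Equiv.Perm (Input n)) (j : Fin M) :
    (guesswork (planted h b w) σ (planted h b w (w j)) : ℝ) = ∑ t ∈ Finset.range (2 ^ n),
      if ∀ x ∈ guessed σ t, planted h b w x ≠ b (firstUser w j) then 1 else 0 := by
  rw [guesswork_eq_sum, guessed_full, planted_password]
  refine Finset.sum_congr rfl fun t _ => ?_
  have : ¬ ∀ x ∈ Finset.univ, planted h b w x ≠ b (firstUser w j) :=
    fun hx => hx (w j) (Finset.mem_univ _) (planted_password h w b j)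
  rw [if_neg this, sub_zero]

end Planted

/-! ### Estimates of geometric sums -/

section GeometricSums

variable {q : ℝ} (N : ℕ)

theorem geom_sum_one_sub (hq : 0 < q) :
    ∑ t ∈ Finset.range N, (1 - q) ^ t = (1 - (1 - q) ^ N) / q := by
  rw [eq_div_iff hq.ne', mul_comm, ← mul_neg_geom_sum, sub_sub_cancel]

theorem geom_sum_one_sub_le (hq : 0 < q) (hq1 : q ≤ 1) :
    ∑ t ∈ Finset.range N, (1 - q) ^ t ≤ 1 / q := by
  rw [geom_sum_one_sub N hq]
  have : 0 ≤ (1 - q) ^ N := pow_nonneg (by linarith) N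
  gcongr
  linarith

theorem sum_geom_sub_last_nonneg (hq : 0 < q) (hq1 : q ≤ 1) :
    0 ≤ ∑ t ∈ Finset.range N, ((1 - q) ^ t - (1 - q) ^ N) :=
  Finset.sum_nonneg fun t ht => sub_nonneg.mpr <|
    pow_le_pow_of_le_one (by linarith) (by linarith) (Finset.mem_range.mp ht).le

theorem sum_geom_sub_last_le (hq : 0 < q) (hq1 : q ≤ 1) :
    ∑ t ∈ Finset.range N, ((1 - q) ^ t - (1 - q) ^ N) ≤ 1 / q :=
  (Finset.sum_le_sum fun t _ => sub_le_self _ (pow_nonneg (by linarith) N)).trans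
    (geom_sum_one_sub_le N hq hq1)

/-- With `x = N * q` the sum is `(1 - (1 + x) * (1 - q) ^ N) / q`, and `(1 + x) * exp (-x) ≤ 2 / x`
because `exp x ≥ 1 + x + x ^ 2 / 2`. -/
theorem le_sum_geom_sub_last (hN : 0 < N) (hq : 0 < q) (hq1 : q ≤ 1) :
    1 / q * (1 - 2 / (N * q)) ≤ ∑ t ∈ Finset.range N, ((1 - q) ^ t - (1 - q) ^ N) := by
  have hN' : (0 : ℝ) < N := by exact_mod_cast hN
  rw [Finset.sum_sub_distrib, geom_sum_one_sub N hq, Finset.sum_const, Finset.card_range,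
    nsmul_eq_mul]
  have hx : 0 < N * q := by positivity
  have hexp : (1 - q) ^ N ≤ Real.exp (-(N * q)) := by
    rw [← mul_neg, Real.exp_nat_mul]
    exact pow_le_pow_left₀ (by linarith) (Real.one_sub_le_exp_neg q) N
  have hquad := Real.quadratic_le_exp_of_nonneg hx.le
  have hle : (1 + N * q) * (1 - q) ^ N ≤ 2 / (N * q) := by
    rw [Real.exp_neg, ← one_div] at hexp
    calc (1 + N * q) * (1 - q) ^ N ≤ (1 + N * q) * (1 / Real.exp (N * q)) := by gcongr
      _ ≤ 2 / (N * q) := by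
        rw [mul_one_div, div_le_div_iff₀ (Real.exp_pos _) hx]
        nlinarith
  have : (1 - (1 - q) ^ N) / q - N * (1 - q) ^ N = 1 / q * (1 - (1 + N * q) * (1 - q) ^ N) := by
    field_simp
    ring
  rw [this]
  gcongr

theorem sq_mul_sum_geom (q : ℝ) :
    q ^ 2 * ∑ t ∈ Finset.range N, ((N : ℝ) - t) * (1 - q) ^ t =
      N * q - (1 - q) * (1 - (1 - q) ^ N) := by
  induction N with
  | zero => simp
  | succ N ih =>
    have hsum : ∑ t ∈ Finset.range (N + 1), (((N + 1 : ℕ) : ℝ) - t) * (1 - q) ^ t =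
        ∑ t ∈ Finset.range N, ((N : ℝ) - t) * (1 - q) ^ t +
          ∑ t ∈ Finset.range (N + 1), (1 - q) ^ t := by
      rw [Finset.sum_range_succ, Finset.sum_range_succ, ← add_assoc, ← Finset.sum_add_distrib]
      congr 1
      · refine Finset.sum_congr rfl fun t _ => ?_
        push_cast
        ring
      · push_cast
        ring
    have hgeom := mul_neg_geom_sum (1 - q) (N + 1)
    rw [sub_sub_cancel] at hgeom
    rw [hsum, mul_add, ih, sq, mul_assoc, hgeom]
    push_cast
    ring

theorem le_sum_geom_weighted (hN : 0 < N) (hq : 0 < q) (hq1 : q ≤ 1) :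
    1 / q * (1 - 2 / (N * q)) ≤
      ∑ t ∈ Finset.range N, (1 - (t : ℝ) / N) * (1 - q) ^ t := by
  have hN' : (0 : ℝ) < N := by exact_mod_cast hN
  have hpow : 0 ≤ (1 - q) ^ N := pow_nonneg (by linarith) N
  have key := sq_mul_sum_geom N q
  have hrw : ∑ t ∈ Finset.range N, ((N : ℝ) - t) * (1 - q) ^ t =
      N * ∑ t ∈ Finset.range N, (1 - (t : ℝ) / N) * (1 - q) ^ t := by
    rw [Finset.mul_sum]
    refine Finset.sum_congr rfl fun t _ => ?_
    field_simp
  rw [hrw] at key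
  have hlhs : 1 / q * (1 - 2 / (N * q)) = (N * q - 2) / (q ^ 2 * N) := by field_simp
  rw [hlhs, div_le_iff₀ (by positivity)]
  nlinarith

end GeometricSums

/-! ### Bounds on the average guesswork -/

section Expectation

variable {n m M : ℕ} {p : ℝ}

theorem sum_hash_avoid (S : Finset (Input n)) (c : Bin m) :
    ∑ h : HashFn n m, (∏ i, bernoulliMass p (h i)) * (if ∀ x ∈ S, h x ≠ c then 1 else 0) =
      (1 - bernoulliMass p c) ^ S.card := by
  convert sum_prod_mul_avoid (sum_bernoulliMass p) S c

theorem hashProb_nonneg (h0 : 0 < p) (h1 : p < 1) (h : HashFn n m) :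
    0 ≤ ∏ i, bernoulliMass p (h i) :=
  Finset.prod_nonneg fun i _ => (bernoulliMass_pos h0 h1 (h i)).le

theorem sum_hash_guesswork (σ : Equiv.Perm (Input n)) (c : Bin m) :
    ∑ h : HashFn n m, (∏ i, bernoulliMass p (h i)) * (guesswork h σ c : ℝ) =
      ∑ t ∈ Finset.range (2 ^ n),
        ((1 - bernoulliMass p c) ^ t - (1 - bernoulliMass p c) ^ (2 ^ n)) := by
  simp only [guesswork_eq_sum, Finset.mul_sum]
  rw [Finset.sum_comm]
  refine Finset.sum_congr rfl fun t ht => ?_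
  simp only [mul_sub, Finset.sum_sub_distrib, sum_hash_avoid, card_guessed σ le_rfl,
    card_guessed σ (Finset.mem_range.mp ht).le]

theorem averageGuesswork_direct {f : Key n m ≃ HashFn n m} (hf : p = 1 / 2 ∨ f = segmented n m)
    (b : Fin M → Bin m) (σ : Fin M → Equiv.Perm (Input n)) :
    averageGuesswork .direct p f b σ = (∑ j, ∑ t ∈ Finset.range (2 ^ n),
      ((1 - bernoulliMass p (b j)) ^ t - (1 - bernoulliMass p (b j)) ^ (2 ^ n))) / M := by
  unfold averageGuesswork
  rw [sum_key_eq_sum_hash hf fun h => usersGuesswork h b σ .direct]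
  simp only [usersGuesswork, mul_div_assoc', Finset.mul_sum,
    ← Finset.sum_div]
  rw [Finset.sum_comm]
  simp only [sum_hash_guesswork]

theorem averageGuesswork_backdoor {f : Key n m ≃ HashFn n m}
    (hf : p = 1 / 2 ∨ f = segmented n m)
    (b : Fin M → Bin m) (σ : Fin M → Equiv.Perm (Input n)) :
    averageGuesswork .backdoor p f b σ = (∑ j, ∑ w : Fin M → Input n,
      (∏ _i : Fin M, (1 / 2 ^ n : ℝ)) * ∑ h : HashFn n m, (∏ i, bernoulliMass p (h i)) *
        (guesswork (planted h b w) (σ j) (planted h b w (w j)) : ℝ)) / M := by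
  unfold averageGuesswork
  rw [sum_key_eq_sum_hash hf fun h => usersGuesswork h b σ .backdoor]
  simp only [usersGuesswork, Finset.sum_div, Finset.mul_sum, Finset.prod_const,
    Finset.card_univ, Fintype.card_fin]
  rw [Finset.sum_comm, Finset.sum_comm (s := (Finset.univ : Finset (Fin M)))]
  refine Finset.sum_congr rfl fun w _ => ?_
  rw [Finset.sum_comm]
  refine Finset.sum_congr rfl fun j _ => Finset.sum_congr rfl fun h _ => ?_
  rw [one_div, inv_pow]
  ring

theorem sum_uniform (n : ℕ) : ∑ _x : Input n, (1 / 2 ^ n : ℝ) = 1 := by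
  simp

/-- With planted passwords `w`, user `j` has expected guesswork at least that of his own bin,
as long as his password has not been guessed. -/
theorem le_sum_hash_guesswork_planted (h0 : 0 < p) (h1 : p < 1) {b : Fin M → Bin m}
    (hb : IsLeastLikely p b) (σ : Equiv.Perm (Input n)) (w : Fin M → Input n) (j : Fin M) :
    ∑ t ∈ Finset.range (2 ^ n),
        (if w j ∈ guessed σ t then 0 else (1 - bernoulliMass p (b j)) ^ t) ≤
      ∑ h : HashFn n m, (∏ i, bernoulliMass p (h i)) *
        (guesswork (planted h b w) σ (planted h b w (w j)) : ℝ) := by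
  simp only [guesswork_planted_eq_sum, Finset.mul_sum]
  rw [Finset.sum_comm]
  refine Finset.sum_le_sum fun t ht => ?_
  split_ifs with hw
  · refine Finset.sum_nonneg fun h _ => mul_nonneg (hashProb_nonneg h0 h1 h) ?_
    split_ifs <;> norm_num
  -- A shared password is mapped to the bin of an earlier user, which is no likelier, so missing it
  -- is at least as probable.
  · calc (1 - bernoulliMass p (b j)) ^ t
        ≤ (1 - bernoulliMass p (b (firstUser w j))) ^ t := by
          refine pow_le_pow_left₀ (by linarith [bernoulliMass_le_one h0 h1 (b j)]) ?_ t
          linarith [hb.monotone (firstUser_le w j)]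
      _ = ∑ h : HashFn n m, (∏ i, bernoulliMass p (h i)) *
          (if ∀ x ∈ guessed σ t, h x ≠ b (firstUser w j) then 1 else 0) := by
          rw [sum_hash_avoid, card_guessed σ (Finset.mem_range.mp ht).le]
      _ ≤ _ := by
          refine Finset.sum_le_sum fun h _ =>
            mul_le_mul_of_nonneg_left ?_ (hashProb_nonneg h0 h1 h)
          by_cases hx : ∀ x ∈ guessed σ t, h x ≠ b (firstUser w j)
          · rw [if_pos hx, if_pos]
            intro x hxt
            by_cases hxw : ∃ i, w i = x
            · obtain ⟨i, rfl⟩ := hxw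
              intro hcon
              rw [planted_password_eq_iff h w hb.injective] at hcon
              exact hw (hcon ▸ hxt)
            · rw [planted_of_notMem h w b (not_exists.mp hxw)]
              exact hx x hxt
          · rw [if_neg hx]
            split_ifs <;> norm_num

/-- At least `t - M` of the first `t` guesses are not passwords and keep independent hash values. -/
theorem sum_hash_guesswork_planted_le (h0 : 0 < p) (h1 : p < 1) {b : Fin M → Bin m}
    (σ : Equiv.Perm (Input n)) (w : Fin M → Input n) (j : Fin M) :
    ∑ h : HashFn n m, (∏ i, bernoulliMass p (h i)) *
        (guesswork (planted h b w) σ (planted h b w (w j)) : ℝ) ≤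
      M + 1 / bernoulliMass p (b (firstUser w j)) := by
  simp only [guesswork_planted_eq_sum, Finset.mul_sum]
  rw [Finset.sum_comm]
  set c := b (firstUser w j)
  have hq := bernoulliMass_pos h0 h1 c
  have hq1 := bernoulliMass_le_one h0 h1 c
  have hterm : ∀ t ∈ Finset.range (2 ^ n), ∑ h : HashFn n m, (∏ i, bernoulliMass p (h i)) *
      (if ∀ x ∈ guessed σ t, planted h b w x ≠ c then 1 else 0) ≤
        (1 - bernoulliMass p c) ^ (t - M) := by
    intro t ht
    calc _ ≤ ∑ h : HashFn n m, (∏ i, bernoulliMass p (h i)) *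
          (if ∀ x ∈ guessed σ t \ Finset.univ.image w, h x ≠ c then 1 else 0) := by
          refine Finset.sum_le_sum fun h _ =>
            mul_le_mul_of_nonneg_left ?_ (hashProb_nonneg h0 h1 h)
          by_cases hx : ∀ x ∈ guessed σ t, planted h b w x ≠ c
          · rw [if_pos hx, if_pos]
            intro x hxt
            simp only [Finset.mem_sdiff, Finset.mem_image, Finset.mem_univ, true_and,
              not_exists] at hxt
            rw [← planted_of_notMem h w b hxt.2]
            exact hx x hxt.1
          · rw [if_neg hx]
            split_ifs <;> norm_num
      _ = (1 - bernoulliMass p c) ^ (guessed σ t \ Finset.univ.image w).card :=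
          sum_hash_avoid _ _
      _ ≤ _ := by
          refine pow_le_pow_of_le_one (by linarith) (by linarith) ?_
          have hcard := Finset.le_card_sdiff (Finset.univ.image w) (guessed σ t)
          have himg : (Finset.univ.image w).card ≤ M := by
            simpa using Finset.card_image_le (s := Finset.univ) (f := w)
          rw [card_guessed σ (Finset.mem_range.mp ht).le] at hcard
          omega
  calc _ ≤ ∑ t ∈ Finset.range (2 ^ n), (1 - bernoulliMass p c) ^ (t - M) :=
        Finset.sum_le_sum hterm
    -- The truncated exponent `t - M` is `0` for the first `M` terms; the rest form a full geometric
    -- sum.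
    _ ≤ ∑ t ∈ Finset.range (M + 2 ^ n), (1 - bernoulliMass p c) ^ (t - M) :=
        Finset.sum_le_sum_of_subset_of_nonneg
          (Finset.range_subset_range.mpr (Nat.le_add_left _ _))
          fun _ _ _ => pow_nonneg (by linarith) _
    _ = M + ∑ t ∈ Finset.range (2 ^ n), (1 - bernoulliMass p c) ^ t := by
        rw [Finset.sum_range_add]
        congr 1
        · rw [Finset.sum_congr rfl fun t ht => by
            rw [Nat.sub_eq_zero_of_le (Finset.mem_range.mp ht).le, pow_zero]]
          simp
        · simp
    _ ≤ _ := by gcongr; exact geom_sum_one_sub_le _ hq hq1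

/-- A uniform password is still unguessed after `t` guesses with probability `1 - t / 2 ^ n`. -/
theorem sum_passwords_unguessed (σ : Equiv.Perm (Input n)) (j : Fin M) (y : ℝ) :
    ∑ w : Fin M → Input n, (∏ _i : Fin M, (1 / 2 ^ n : ℝ)) *
        ∑ t ∈ Finset.range (2 ^ n), (if w j ∈ guessed σ t then 0 else y ^ t) =
      ∑ t ∈ Finset.range (2 ^ n), (1 - (t : ℝ) / (2 ^ n : ℕ)) * y ^ t := by
  rw [sum_prod_mul_eval (μ := fun _ : Input n => (1 / 2 ^ n : ℝ)) (sum_uniform n) j fun x =>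
    ∑ t ∈ Finset.range (2 ^ n), (if x ∈ guessed σ t then 0 else y ^ t)]
  simp only [Finset.mul_sum]
  rw [Finset.sum_comm]
  refine Finset.sum_congr rfl fun t ht => ?_
  have ht' := (Finset.mem_range.mp ht).le
  rw [← Finset.mul_sum, Finset.sum_ite, Finset.sum_const_zero, zero_add, Finset.sum_const,
    nsmul_eq_mul]
  have : (Finset.univ.filter fun x => x ∉ guessed σ t).card = 2 ^ n - t := by
    have hcard := Finset.card_compl (guessed σ t)
    rw [card_guessed σ ht', Fintype.card_fin] at hcard
    rw [← hcard]
    congr 1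
    ext x
    simp
  rw [this, Nat.cast_sub ht']
  push_cast
  field_simp

/-- The expected guesswork is at least what any subset of the users contributes to it. -/
theorem le_averageGuesswork (A : Allocation) (h0 : 0 < p) (h1 : p < 1)
    {f : Key n m ≃ HashFn n m} (hf : p = 1 / 2 ∨ f = segmented n m) {b : Fin M → Bin m}
    (hb : IsLeastLikely p b) (σ : Fin M → Equiv.Perm (Input n)) (S : Finset (Fin M)) :
    (∑ j ∈ S, 1 / bernoulliMass p (b j) * (1 - 2 / (2 ^ n * bernoulliMass p (b j)))) / M ≤
      averageGuesswork A p f b σ := by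
  have hq := fun j => bernoulliMass_pos h0 h1 (b j)
  have hq1 := fun j => bernoulliMass_le_one h0 h1 (b j)
  have hN : 0 < 2 ^ n := by positivity
  -- The lower bound can be negative for very unlikely bins; users outside `S` are dropped using `0
  -- ≤ e j` instead.
  suffices hsuff : ∃ e : Fin M → ℝ, averageGuesswork A p f b σ = (∑ j, e j) / M ∧
      (∀ j, 0 ≤ e j) ∧ ∀ j, 1 / bernoulliMass p (b j) *
        (1 - 2 / (2 ^ n * bernoulliMass p (b j))) ≤ e j by
    obtain ⟨e, he, hpos, hle⟩ := hsuff
    rw [he]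
    gcongr
    exact (Finset.sum_le_sum fun j _ => hle j).trans
      (Finset.sum_le_sum_of_subset_of_nonneg (Finset.subset_univ S) fun j _ _ => hpos j)
  cases A with
  | direct =>
    refine ⟨_, averageGuesswork_direct hf b σ,
      fun j => sum_geom_sub_last_nonneg _ (hq j) (hq1 j), fun j => ?_⟩
    exact_mod_cast le_sum_geom_sub_last _ hN (hq j) (hq1 j)
  | backdoor =>
    refine ⟨_, averageGuesswork_backdoor hf b σ, fun j => ?_, fun j => ?_⟩
    · exact Finset.sum_nonneg fun w _ => mul_nonneg (by positivity) <|
        Finset.sum_nonneg fun h _ => mul_nonneg (hashProb_nonneg h0 h1 h) (Nat.cast_nonneg _)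
    · have hle := le_sum_geom_weighted _ hN (hq j) (hq1 j)
      rw [← sum_passwords_unguessed (σ j) j] at hle
      push_cast at hle
      refine hle.trans (Finset.sum_le_sum fun w _ => mul_le_mul_of_nonneg_left ?_ (by positivity))
      exact le_sum_hash_guesswork_planted h0 h1 hb (σ j) w j

theorem averageGuesswork_half_le (A : Allocation) (f : Key n m ≃ HashFn n m)
    (b : Fin M → Bin m) (σ : Fin M → Equiv.Perm (Input n)) (hM : 0 < M) :
    averageGuesswork A (1 / 2) f b σ ≤ M + 2 ^ m := by
  have hM' : (0 : ℝ) < M := by exact_mod_cast hM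
  have h0 : (0 : ℝ) < 1 / 2 := by norm_num
  have h1 : (1 / 2 : ℝ) < 1 := by norm_num
  have hmass : ∀ c : Bin m, 1 / bernoulliMass (1 / 2) c = 2 ^ m := fun c => by
    rw [bernoulliMass_half]; simp
  suffices hsuff : ∃ e : Fin M → ℝ, averageGuesswork A (1 / 2) f b σ = (∑ j, e j) / M ∧
      ∀ j, e j ≤ M + 2 ^ m by
    obtain ⟨e, he, hle⟩ := hsuff
    rw [he, div_le_iff₀ hM']
    calc ∑ j, e j ≤ ∑ _j : Fin M, ((M : ℝ) + 2 ^ m) := Finset.sum_le_sum fun j _ => hle j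
      _ = _ := by simp; ring
  cases A with
  | direct =>
    refine ⟨_, averageGuesswork_direct (.inl rfl) b σ, fun j => ?_⟩
    have := sum_geom_sub_last_le (2 ^ n) (bernoulliMass_pos h0 h1 (b j))
      (bernoulliMass_le_one h0 h1 (b j))
    rw [hmass] at this
    linarith
  | backdoor =>
    refine ⟨_, averageGuesswork_backdoor (.inl rfl) b σ, fun j => ?_⟩
    calc _ ≤ ∑ w : Fin M → Input n, (∏ _i : Fin M, (1 / 2 ^ n : ℝ)) * ((M : ℝ) + 2 ^ m) := by
          refine Finset.sum_le_sum fun w _ => mul_le_mul_of_nonneg_left ?_ (by positivity)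
          rw [← hmass (b (firstUser w j))]
          exact sum_hash_guesswork_planted_le h0 h1 (σ j) w j
      _ = _ := by
          rw [← Finset.sum_mul,
            sum_prod_eq_one (ι := Fin M) (μ := fun _ : Input n => (1 / 2 ^ n : ℝ))
              (sum_uniform n), one_mul]

theorem usersGuesswork_le (h : HashFn n m) (b : Fin M → Bin m)
    (σ : Fin M → Equiv.Perm (Input n)) (A : Allocation) (hM : 0 < M) :
    usersGuesswork h b σ A ≤ 2 ^ n := by
  have hM' : (0 : ℝ) < M := by exact_mod_cast hM
  have hmean : ∀ g : Fin M → ℕ, (∀ j, g j ≤ 2 ^ n) → (∑ j, (g j : ℝ)) / M ≤ 2 ^ n := by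
    intro g hg
    rw [div_le_iff₀ hM']
    calc ∑ j, (g j : ℝ) ≤ ∑ _j : Fin M, (2 : ℝ) ^ n :=
          Finset.sum_le_sum fun j _ => by exact_mod_cast hg j
      _ = _ := by simp [mul_comm]
  cases A with
  | direct => exact hmean _ fun j => guesswork_le _ _ _
  | backdoor =>
    simp only [usersGuesswork]
    rw [div_le_iff₀ (by positivity)]
    calc _ ≤ ∑ _w : Fin M → Input n, (2 : ℝ) ^ n :=
          Finset.sum_le_sum fun w _ => hmean _ fun j => guesswork_le _ _ _
      _ = _ := by simp [mul_comm]

theorem averageGuesswork_le (A : Allocation) (h0 : 0 < p) (h1 : p < 1)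
    (f : Key n m ≃ HashFn n m) (b : Fin M → Bin m) (σ : Fin M → Equiv.Perm (Input n))
    (hM : 0 < M) : averageGuesswork A p f b σ ≤ 2 ^ n :=
  calc averageGuesswork A p f b σ ≤ ∑ k : Key n m, bernoulliMass p k * (2 : ℝ) ^ n :=
        Finset.sum_le_sum fun k _ => mul_le_mul_of_nonneg_left (usersGuesswork_le _ b σ A hM)
          (bernoulliMass_pos h0 h1 k).le
    _ = 2 ^ n := by rw [← Finset.sum_mul, sum_bernoulliMass, one_mul]

end Expectation

/-! ### Uniform key -/

section UniformKey

variable {n l M : ℕ}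

theorem isLeastLikely_half {b : Fin M → Bin l} (hb : Function.Injective b) :
    IsLeastLikely (1 / 2) b where
  injective := hb
  monotone := fun _ _ _ => by simp only [bernoulliMass_half, le_refl]
  least := fun _ _ _ => by simp only [bernoulliMass_half, le_refl]

/-- `l + 2 ≤ n` gives `2 / (2 ^ n * q) ≤ 1 / 2`, so half of `1 / q = 2 ^ l` is guaranteed. -/
theorem achieves_half (A : Allocation) (f : Key n l ≃ HashFn n l) {g : ℝ} (hM : 0 < M)
    (hMl : M ≤ 2 ^ l) (hl : l + 2 ≤ n) (hg : 2 * g ≤ 2 ^ l) : Achieves A (1 / 2) f M g := by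
  refine ⟨hMl, fun b σ hb => ?_⟩
  have hM' : (0 : ℝ) < M := by exact_mod_cast hM
  refine le_trans ?_ (le_averageGuesswork A (by norm_num) (by norm_num) (.inl rfl) hb σ Finset.univ)
  have hinv : (1 : ℝ) / (1 / 2) ^ l = 2 ^ l := by simp
  have hratio : (2 : ℝ) / (2 ^ n * (1 / 2) ^ l) ≤ 1 / 2 := by
    have : (2 : ℝ) ^ (l + 2) ≤ 2 ^ n := pow_le_pow_right₀ (by norm_num) hl
    have hx : (2 : ℝ) ^ l * (1 / 2) ^ l = 1 := by rw [← mul_pow]; norm_num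
    have hy : (0 : ℝ) < (1 / 2) ^ l := by positivity
    rw [div_le_iff₀ (by positivity)]
    rw [pow_add] at this
    nlinarith
  simp only [bernoulliMass_half, hinv, Finset.sum_const, Finset.card_univ, Fintype.card_fin,
    nsmul_eq_mul]
  rw [mul_div_cancel_left₀ _ hM'.ne']
  have : (0 : ℝ) < 2 ^ l := by positivity
  nlinarith

theorem Achieves.le_of_half {A : Allocation} {f : Key n l ≃ HashFn n l} {g : ℝ} (hM : 0 < M)
    (h : Achieves A (1 / 2) f M g) : g ≤ M + 2 ^ l := by
  -- An allocation must be exhibited, since the quantified clause of `Achieves` would otherwise be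
  -- vacuous.
  obtain ⟨b⟩ : Nonempty (Fin M ↪ Bin l) :=
    Function.Embedding.nonempty_of_card_le (by simpa using h.1)
  exact (h.2 b (fun _ => 1) (isLeastLikely_half b.injective)).trans
    (averageGuesswork_half_le A f b _ hM)

end UniformKey

/-! ### Likelihood by number of ones -/

section Weight

variable {m : ℕ} {p : ℝ}

/-- The number of ones in a bit string. -/
def weight (v : Bin m) : ℕ := (Finset.univ.filter fun i => v i = true).card

theorem weight_le (v : Bin m) : weight v ≤ m :=
  (Finset.card_filter_le _ _).trans (by simp)

theorem weight_not_add (v : Bin m) : weight (fun i => !v i) + weight v = m := by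
  have := Finset.card_filter_add_card_filter_not (s := (Finset.univ : Finset (Fin m)))
    fun i => v i = true
  simp only [Finset.card_univ, Fintype.card_fin] at this
  simp only [weight, Bool.not_eq_true']
  simp only [Bool.not_eq_true] at this
  omega

theorem bernoulliMass_eq_weight (p : ℝ) (v : Bin m) :
    bernoulliMass p v = p ^ weight v * (1 - p) ^ (m - weight v) := by
  have hnot : (Finset.univ.filter fun i => ¬ v i = true).card = m - weight v := by
    have := weight_not_add v
    simp only [weight, Bool.not_eq_true', Bool.not_eq_true] at this ⊢
    omega
  unfold bernoulliMass
  rw [Finset.prod_ite, Finset.prod_const, Finset.prod_const, hnot]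
  rfl

theorem bernoulliMass_lt_of_weight_lt (h0 : 0 < p) (h1 : p < 1 / 2) {v w : Bin m}
    (h : weight v < weight w) : bernoulliMass p w < bernoulliMass p v := by
  obtain ⟨d, hd⟩ := Nat.exists_eq_add_of_lt h
  have hw := weight_le w
  have e : m - weight v = (m - weight w) + (d + 1) := by omega
  have hpos : 0 < p ^ weight v * (1 - p) ^ (m - weight w) :=
    mul_pos (pow_pos h0 _) (pow_pos (by linarith) _)
  rw [bernoulliMass_eq_weight, bernoulliMass_eq_weight, e, pow_add,
    show weight w = weight v + (d + 1) by omega, pow_add,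
    ← show weight w = weight v + (d + 1) by omega]
  have := pow_lt_pow_left₀ (by linarith : p < 1 - p) h0.le (n := d + 1) (by omega)
  nlinarith

theorem card_filter_weight (m j : ℕ) :
    (Finset.univ.filter fun v : Bin m => weight v = j).card = m.choose j := by
  have hcard : m.choose j = (Finset.powersetCard j (Finset.univ : Finset (Fin m))).card := by simp
  rw [hcard]
  refine Finset.card_nbij' (fun v => Finset.univ.filter fun i => v i = true)
    (fun s i => decide (i ∈ s)) ?_ ?_ ?_ ?_
  · intro v hv
    rw [Finset.mem_coe, Finset.mem_filter] at hv
    simpa [Finset.mem_powersetCard, weight] using hv.2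
  · intro s hs
    rw [Finset.mem_coe, Finset.mem_powersetCard] at hs
    rw [Finset.mem_coe, Finset.mem_filter]
    simpa [weight] using hs.2
  · intro v _
    simp
  · intro s _
    simp

/-- A bin with more ones than zeros is among the `2 ^ (m - 1)` least likely ones. -/
theorem mem_range_of_lt_weight (h0 : 0 < p) (h1 : p < 1 / 2) {b : Fin (2 ^ (m - 1)) → Bin m}
    (hb : IsLeastLikely p b) {c : Bin m} (hc : m < 2 * weight c) : c ∈ Set.range b := by
  by_contra hcon
  have hbw : ∀ j, weight c ≤ weight (b j) := fun j => by
    by_contra! hlt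
    exact absurd (hb.least c hcon j) (not_le.mpr (bernoulliMass_lt_of_weight_lt h0 h1 hlt))
  -- These are `2 ^ (m - 1) + 1` strings with more ones than zeros. Their bitwise complements are as
  -- many further strings, too many in all.
  set S := insert c (Finset.univ.image b)
  have hSw : ∀ v ∈ S, m < 2 * weight v := by
    intro v hv
    rcases Finset.mem_insert.mp hv with rfl | hv
    · exact hc
    · obtain ⟨j, -, rfl⟩ := Finset.mem_image.mp hv
      have := hbw j
      omega
  have hS : S.card = 2 ^ (m - 1) + 1 := by
    rw [Finset.card_insert_of_notMem, Finset.card_image_of_injective _ hb.injective]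
    · simp
    · simpa using hcon
  have hinj : Function.Injective fun (v : Bin m) i => !v i := fun v w hvw => by
    ext i
    simpa using congrFun hvw i
  have hdisj : Disjoint S (S.image fun v i => !v i) := by
    rw [Finset.disjoint_left]
    intro v hv hv'
    obtain ⟨w, hw, rfl⟩ := Finset.mem_image.mp hv'
    have e1 := hSw _ hv
    have e2 := hSw _ hw
    have e3 := weight_not_add w
    omega
  have hcard := Finset.card_le_univ (S ∪ S.image fun v i => !v i)
  rw [Finset.card_union_of_disjoint hdisj, Finset.card_image_of_injective _ hinj, hS] at hcard
  have hm : m ≠ 0 := by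
    have := weight_le c
    omega
  have h2 := mul_pow_sub_one hm 2
  simp only [Fintype.card_fun, Fintype.card_bool, Fintype.card_fin] at hcard
  omega

theorem choose_le_card_weight (h0 : 0 < p) (h1 : p < 1 / 2) {b : Fin (2 ^ (m - 1)) → Bin m}
    (hb : IsLeastLikely p b) {j : ℕ} (hj : m < 2 * j) :
    m.choose j ≤ (Finset.univ.filter fun i => weight (b i) = j).card := by
  rw [← card_filter_weight]
  refine (Finset.card_le_card (t := (Finset.univ.filter fun i => weight (b i) = j).image b)
    fun c hc => ?_).trans Finset.card_image_le
  have hcj : weight c = j := by simpa using hc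
  obtain ⟨i, rfl⟩ := mem_range_of_lt_weight h0 h1 hb (hcj ▸ hj)
  exact Finset.mem_image_of_mem b (by simpa using hcj)

/-- Only the users whose bins have `j` ones are kept; `4 ≤ 2 ^ n * q` leaves at least half of `1 /
q` for each. -/
theorem le_averageGuesswork_weight (A : Allocation) {n : ℕ} (h0 : 0 < p) (h1 : p < 1 / 2)
    {b : Fin (2 ^ (m - 1)) → Bin m} (hb : IsLeastLikely p b)
    (σ : Fin (2 ^ (m - 1)) → Equiv.Perm (Input n)) {j : ℕ} (hj : m < 2 * j) {q : ℝ}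
    (hq : q = p ^ j * (1 - p) ^ (m - j)) (hNq : 4 ≤ 2 ^ n * q) :
    m.choose j * (1 / (2 * q)) / 2 ^ (m - 1) ≤ averageGuesswork A p (segmented n m) b σ := by
  have hq0 : 0 < q := hq ▸ mul_pos (pow_pos h0 _) (pow_pos (by linarith) _)
  have hmass : ∀ i ∈ Finset.univ.filter fun i => weight (b i) = j,
      bernoulliMass p (b i) = q := fun i hi => by
    rw [bernoulliMass_eq_weight, (Finset.mem_filter.mp hi).2, hq]
  refine le_trans ?_ (le_averageGuesswork A h0 (by linarith) (.inr rfl) hb σ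
    (Finset.univ.filter fun i => weight (b i) = j))
  rw [Finset.sum_congr rfl fun i hi => by rw [hmass i hi], Finset.sum_const, nsmul_eq_mul]
  push_cast
  have hhalf : 1 / (2 * q) ≤ 1 / q * (1 - 2 / (2 ^ n * q)) := by
    have : 2 / (2 ^ n * q) ≤ 1 / 2 := by
      rw [div_le_iff₀ (by linarith)]
      linarith
    calc 1 / (2 * q) = 1 / q * (1 - 1 / 2) := by field_simp; norm_num
      _ ≤ _ := by gcongr
  gcongr
  exact choose_le_card_weight h0 h1 hb hj

end Weight

/-! ### Binomial coefficients near the middle -/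

section Binomial

theorem two_pow_le_succ_mul_choose_middle (m : ℕ) : 2 ^ m ≤ (m + 1) * m.choose (m / 2) := by
  rw [← Nat.sum_range_choose]
  calc _ ≤ ∑ _i ∈ Finset.range (m + 1), m.choose (m / 2) :=
        Finset.sum_le_sum fun i _ => Nat.choose_le_middle i m
    _ = _ := by simp

/-- Consecutive coefficients have ratio `(m - j) / (j + 1)`, which stays above `ρ` this close to the
middle. -/
theorem pow_mul_choose_middle_le {ρ : ℝ} (hρ0 : 0 < ρ) (hρ1 : ρ ≤ 1) {m k : ℕ}
    (hk : 2 * (k : ℝ) + 1 ≤ (1 - ρ) * m / 2) :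
    ρ ^ k * m.choose (m / 2) ≤ m.choose (m / 2 + k) := by
  induction k with
  | zero => simp
  | succ k ih =>
    push_cast at hk
    have hj : ((m / 2 : ℕ) : ℝ) ≤ m / 2 := by exact_mod_cast Nat.cast_div_le (α := ℝ)
    have ih' := ih (by linarith)
    have hjm : m / 2 + k ≤ m := by
      have : ((m / 2 + k : ℕ) : ℝ) ≤ m := by push_cast; nlinarith
      exact_mod_cast this
    have hrec : (m.choose (m / 2 + k + 1) : ℝ) * ((m / 2 : ℕ) + k + 1) =
        m.choose (m / 2 + k) * (m - ((m / 2 : ℕ) + k)) := by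
      have := Nat.choose_succ_right_eq m (m / 2 + k)
      have hcast := congrArg (Nat.cast (R := ℝ)) this
      rw [Nat.cast_mul, Nat.cast_mul, Nat.cast_sub hjm] at hcast
      simpa using hcast
    have hstep : ρ * ((m / 2 : ℕ) + k + 1) ≤ m - ((m / 2 : ℕ) + k) := by nlinarith
    have hpos : (0 : ℝ) < (m / 2 : ℕ) + k + 1 := by positivity
    rw [← add_assoc]
    refine le_of_mul_le_mul_right ?_ hpos
    rw [hrec]
    calc ρ ^ (k + 1) * m.choose (m / 2) * ((m / 2 : ℕ) + k + 1)
        = (ρ ^ k * m.choose (m / 2)) * (ρ * ((m / 2 : ℕ) + k + 1)) := by ring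
      _ ≤ m.choose (m / 2 + k) * (m - ((m / 2 : ℕ) + k)) := by gcongr

end Binomial

/-! ### Bias parameter and middle mass -/

section Bias

variable {p s : ℝ}

/-- The mass of a string with `k` ones in excess of half, times `((1 - p) / p) ^ k`. -/
theorem mass_mul_ratio_pow (h0 : 0 < p) {m k : ℕ} (hk : m / 2 + k ≤ m) :
    p ^ (m / 2 + k) * (1 - p) ^ (m - (m / 2 + k)) * ((1 - p) / p) ^ k =
      p ^ (m / 2) * (1 - p) ^ (m - m / 2) := by
  have e : m - m / 2 = (m - (m / 2 + k)) + k := by omega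
  rw [e, pow_add, pow_add, div_pow]
  have : p ^ k ≠ 0 := (pow_pos h0 k).ne'
  field_simp

/-- For even `m` the mass is exactly `s ^ m`. For odd `m` one factor `s` is replaced by `1 - p`,
which lies between `s` and `s * ((1 - p) / p)`. -/
theorem middle_mass_bounds (h0 : 0 < p) (h1 : p ≤ 1 / 2) (hs : 0 < s) (hsp : s ^ 2 = p * (1 - p))
    (m : ℕ) : s ^ m ≤ p ^ (m / 2) * (1 - p) ^ (m - m / 2) ∧
      p ^ (m / 2) * (1 - p) ^ (m - m / 2) ≤ s ^ m * ((1 - p) / p) := by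
  have hr : 1 ≤ (1 - p) / p := by rw [le_div_iff₀ h0]; linarith
  have hps : p ≤ s := by
    refine le_of_sq_le_sq ?_ hs.le
    nlinarith
  have hsq : s ≤ 1 - p := by
    refine le_of_sq_le_sq ?_ (by linarith)
    nlinarith
  rcases Nat.even_or_odd' m with ⟨a, rfl | rfl⟩
  · rw [show 2 * a / 2 = a by omega, show 2 * a - a = a by omega, ← mul_pow, pow_mul, hsp]
    have : 0 < (p * (1 - p)) ^ a := pow_pos (by nlinarith) a
    exact ⟨le_rfl, le_mul_of_one_le_right this.le hr⟩
  · rw [show (2 * a + 1) / 2 = a by omega, show 2 * a + 1 - a = a + 1 by omega, pow_succ,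
      pow_succ, pow_mul, hsp, ← mul_assoc, ← mul_pow]
    have hpos : 0 < (p * (1 - p)) ^ a := pow_pos (by nlinarith) a
    rw [mul_assoc ((p * (1 - p)) ^ a) s]
    have : 1 - p ≤ s * ((1 - p) / p) := by
      rw [mul_div_assoc', le_div_iff₀ h0]
      nlinarith
    exact ⟨by gcongr, by gcongr⟩

theorem one_add_binaryKL_half (h0 : 0 < p) (h1 : p < 1) :
    1 + binaryKL (1 / 2) p = -(Real.logb 2 (p * (1 - p)) / 2) := by
  have h1' : 1 - p ≠ 0 := by linarith
  have hhalf : (1 : ℝ) - 1 / 2 = 1 / 2 := by norm_num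
  unfold binaryKL
  rw [hhalf, Real.logb_div (by norm_num) h0.ne', Real.logb_div (by norm_num) h1',
    Real.logb_mul h0.ne' h1']
  have : Real.logb 2 (1 / 2) = -1 := by
    rw [one_div, Real.logb_inv, Real.logb_self_eq_one (by norm_num)]
  rw [this]
  ring

theorem one_add_binaryKL_half_eq_iff (h0 : 0 < p) (h1 : p < 1) (α : ℝ) :
    1 + binaryKL (1 / 2) p = α ↔ ((2 : ℝ) ^ (-α)) ^ 2 = p * (1 - p) := by
  have hpos : 0 < p * (1 - p) := mul_pos h0 (by linarith)
  rw [one_add_binaryKL_half h0 h1, ← Real.rpow_mul_natCast (by norm_num),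
    ← Real.logb_eq_iff_rpow_eq (by norm_num) (by norm_num) hpos]
  push_cast
  constructor <;> intro h <;> linarith

theorem existsUnique_bias {α : ℝ} (hα : 1 < α) :
    ∃! p : ℝ, 0 < p ∧ p ≤ 1 / 2 ∧ 1 + binaryKL (1 / 2) p = α := by
  set s := (2 : ℝ) ^ (-α)
  have hs : 0 < s := by positivity
  have hs2 : s < 1 / 2 := by
    calc s < (2 : ℝ) ^ (-1 : ℝ) := Real.rpow_lt_rpow_of_exponent_lt (by norm_num) (by linarith)
      _ = 1 / 2 := by rw [Real.rpow_neg_one]; norm_num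
  have hd : 0 ≤ 1 - 4 * s ^ 2 := by nlinarith
  have hsq := Real.sq_sqrt hd
  have hr0 := Real.sqrt_nonneg (1 - 4 * s ^ 2)
  have hr1 : √(1 - 4 * s ^ 2) < 1 := by
    rw [Real.sqrt_lt' one_pos]
    nlinarith
  -- The smaller root of `p * (1 - p) = s ^ 2`.
  refine ⟨(1 - √(1 - 4 * s ^ 2)) / 2, ⟨by linarith, by linarith, ?_⟩, ?_⟩
  · rw [one_add_binaryKL_half_eq_iff (by linarith) (by linarith)]
    nlinarith
  · rintro p ⟨h0, h1, hp⟩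
    rw [one_add_binaryKL_half_eq_iff h0 (by linarith)] at hp
    have : √(1 - 4 * s ^ 2) = 1 - 2 * p := by
      rw [Real.sqrt_eq_iff_mul_self_eq hd (by linarith)]
      nlinarith
    rw [this]
    ring

end Bias

/-! ### Asymptotics in `m` -/

section Asymptotics

theorem eventually_mul_log_le {n : ℕ → ℕ} {α : ℝ}
    (hn : Tendsto (fun m : ℕ => ((n m : ℝ) - α * m) / Real.log m) atTop atTop) (K : ℝ) :
    ∀ᶠ m : ℕ in atTop, K * Real.log m ≤ n m - α * m := by
  filter_upwards [hn.eventually_ge_atTop K, eventually_ge_atTop 2] with m hK hm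
  have : 0 < Real.log m := Real.log_pos (by exact_mod_cast hm)
  rwa [le_div_iff₀ this] at hK

theorem eventually_le_log (x : ℝ) : ∀ᶠ m : ℕ in atTop, x ≤ Real.log m :=
  (Real.tendsto_log_atTop.comp tendsto_natCast_atTop_atTop).eventually_ge_atTop x

theorem eventually_log_le {ε : ℝ} (hε : 0 < ε) : ∀ᶠ m : ℕ in atTop, Real.log m ≤ ε * m := by
  filter_upwards [tendsto_natCast_atTop_atTop.eventually (Real.isLittleO_log_id_atTop.bound hε)]
    with m hm
  simpa using (le_abs_self _).trans hm

theorem eventually_add_le {n : ℕ → ℕ} {α : ℝ}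
    (hn : Tendsto (fun m : ℕ => ((n m : ℝ) - α * m) / Real.log m) atTop atTop) (x : ℝ) :
    ∀ᶠ m : ℕ in atTop, α * m + x ≤ n m := by
  filter_upwards [eventually_mul_log_le hn 1, eventually_le_log x] with m h1 h2
  linarith

theorem tendsto_of_linear_bounds {g : ℕ → ℝ} {α x y : ℝ}
    (hl : ∀ᶠ m : ℕ in atTop, α * m - x ≤ g m) (hu : ∀ᶠ m : ℕ in atTop, g m ≤ α * m + y) :
    Tendsto (fun m : ℕ => g m / m) atTop (𝓝 α) := by
  have hlim : ∀ z : ℝ, Tendsto (fun m : ℕ => α + z / m) atTop (𝓝 α) := fun z => by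
    simpa using tendsto_const_nhds.add (tendsto_const_div_atTop_nhds_zero_nat z)
  refine tendsto_of_tendsto_of_tendsto_of_le_of_le' (hlim (-x)) (hlim y) ?_ ?_
  · filter_upwards [hl, eventually_gt_atTop 0] with m hm h0
    have : (0 : ℝ) < m := by exact_mod_cast h0
    rw [le_div_iff₀ this, add_mul, div_mul_cancel₀ _ this.ne']
    linarith
  · filter_upwards [hu, eventually_gt_atTop 0] with m hm h0
    have : (0 : ℝ) < m := by exact_mod_cast h0
    rw [div_le_iff₀ this, add_mul, div_mul_cancel₀ _ this.ne']
    linarith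

theorem two_pow_sub_one_le (m : ℕ) {l : ℕ} (hl : m ≤ l + 1) : 2 ^ (m - 1) ≤ 2 ^ l :=
  Nat.pow_le_pow_right (by norm_num) (by omega)

theorem eventually_achieves_half {α : ℝ} (hα : 1 < α) {n : ℕ → ℕ}
    (hn : Tendsto (fun m : ℕ => ((n m : ℝ) - α * m) / Real.log m) atTop atTop)
    (f : ∀ m l : ℕ, Key (n m) l ≃ HashFn (n m) l) (A : Allocation) :
    ∀ᶠ m : ℕ in atTop,
      Achieves A (1 / 2) (f m (⌈α * m⌉₊ + 1)) (2 ^ (m - 1)) ((2 : ℝ) ^ (α * m)) := by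
  filter_upwards [eventually_add_le hn 4] with m hm
  have hαm : (0 : ℝ) ≤ α * m := by positivity
  have hle := Nat.le_ceil (α * m)
  have hlt := Nat.ceil_lt_add_one hαm
  have hml : m ≤ ⌈α * m⌉₊ := by
    have : (m : ℝ) ≤ ⌈α * m⌉₊ := by nlinarith [Nat.cast_nonneg (α := ℝ) m]
    exact_mod_cast this
  refine achieves_half A _ (by positivity) (two_pow_sub_one_le m (by omega)) ?_ ?_
  · have : ((⌈α * m⌉₊ + 1 + 2 : ℕ) : ℝ) ≤ n m := by push_cast; linarith
    exact_mod_cast this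
  · rw [pow_succ, mul_comm, ← Real.rpow_natCast]
    gcongr
    norm_num

theorem Achieves.sub_one_le_of_half {α : ℝ} {n l m : ℕ} {f : Key n l ≃ HashFn n l}
    {A : Allocation} (h : Achieves A (1 / 2) f (2 ^ (m - 1)) ((2 : ℝ) ^ (α * m))) :
    α * m - 1 ≤ l := by
  have hle := h.le_of_half (by positivity)
  have hM : ((2 ^ (m - 1) : ℕ) : ℝ) ≤ 2 ^ l := by exact_mod_cast h.1
  have : (2 : ℝ) ^ (α * m) ≤ (2 : ℝ) ^ ((l : ℝ) + 1) := by
    rw [Real.rpow_add_one (by norm_num), Real.rpow_natCast]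
    linarith
  rw [Real.rpow_le_rpow_left_iff (by norm_num)] at this
  linarith

theorem eventually_achieves_biased {α p : ℝ} (hα : 1 < α) (h0 : 0 < p) (h1 : p ≤ 1 / 2)
    (hp : 1 + binaryKL (1 / 2) p = α) {n : ℕ → ℕ}
    (hn : Tendsto (fun m : ℕ => ((n m : ℝ) - α * m) / Real.log m) atTop atTop)
    (A : Allocation) :
    ∀ᶠ m : ℕ in atTop,
      Achieves A p (segmented (n m) m) (2 ^ (m - 1)) ((2 : ℝ) ^ (α * m)) := by
  have hsp := (one_add_binaryKL_half_eq_iff h0 (by linarith) α).mp hp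
  set s := (2 : ℝ) ^ (-α) with hs_def
  have hs : 0 < s := by positivity
  have hp2 : p < 1 / 2 := by
    refine lt_of_le_of_ne h1 fun h => ?_
    have : s < (2 : ℝ) ^ (-1 : ℝ) :=
      Real.rpow_lt_rpow_of_exponent_lt (by norm_num) (by linarith)
    rw [Real.rpow_neg_one] at this
    rw [h] at hsp
    nlinarith
  set r := (1 - p) / p with hr_def
  have hr : 1 < r := by rw [lt_div_iff₀ h0]; linarith
  have hr0 : 0 < r := by linarith
  -- Any value strictly between `1 / r` and `1` would serve.
  set ρ := (1 + 1 / r) / 2 with hρ_def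
  have hir : 1 / r < 1 := by rw [div_lt_one hr0]; exact hr
  have hρ0 : 0 < ρ := by positivity
  have hρ1 : ρ < 1 := by rw [hρ_def]; linarith
  have hρr : 1 < ρ * r := by
    have : ρ * r = (r + 1) / 2 := by rw [hρ_def]; field_simp
    linarith
  have hlogρr : 0 < Real.log (ρ * r) := Real.log_pos hρr
  have hlogr : 0 < Real.log r := Real.log_pos hr
  have hlog2 : 0 < Real.log 2 := Real.log_pos (by norm_num)
  -- Chosen so that `k ≥ C * log m` gives `(ρ * r) ^ k ≥ m ^ 2`, enough to absorb `r * (m + 1)`.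
  set C := 2 / Real.log (ρ * r) with hC_def
  have hC : 0 < C := by positivity
  filter_upwards [eventually_mul_log_le hn ((C * Real.log r + 1) / Real.log 2),
    eventually_le_log (Real.log 4 + Real.log r), eventually_le_log (1 / C),
    eventually_log_le (ε := (1 - ρ) / (8 * C)) (div_pos (by linarith) (by positivity)),
    tendsto_natCast_atTop_atTop.eventually_ge_atTop (12 / (1 - ρ)),
    tendsto_natCast_atTop_atTop.eventually_ge_atTop (2 * r), eventually_ge_atTop 1]
    with m hm1 hm2 hm3 hm4 hm5 hm6 hm7
  have hm0 : (0 : ℝ) < m := by exact_mod_cast hm7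
  set k := ⌈C * Real.log m⌉₊ with hk_def
  have hClog : 1 ≤ C * Real.log m := by
    rw [div_le_iff₀ hC] at hm3
    linarith
  have hkge : C * Real.log m ≤ k := Nat.le_ceil _
  have hklt : (k : ℝ) < C * Real.log m + 1 := Nat.ceil_lt_add_one (by linarith)
  have hk1 : 1 ≤ k := by
    have : (1 : ℝ) ≤ k := by linarith
    exact_mod_cast this
  have hkm : 2 * (k : ℝ) + 1 ≤ (1 - ρ) * m / 2 := by
    rw [div_le_iff₀ (by linarith)] at hm5
    have : C * Real.log m ≤ (1 - ρ) * m / 8 := by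
      calc C * Real.log m ≤ C * ((1 - ρ) / (8 * C) * m) := by gcongr
        _ = _ := by field_simp
    linarith
  have hkm' : m / 2 + k ≤ m := by
    have : 2 * (k : ℝ) ≤ m := by nlinarith
    have : 2 * k ≤ m := by exact_mod_cast this
    omega
  have hpow : r * (m + 1) ≤ (ρ * r) ^ k := by
    calc r * (m + 1) ≤ (m : ℝ) ^ 2 := by
          have : (1 : ℝ) ≤ m := by exact_mod_cast hm7
          nlinarith
      _ = Real.exp (2 * Real.log m) := by
          rw [show (2 : ℝ) * Real.log m = (2 : ℕ) * Real.log m by norm_num, Real.exp_nat_mul,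
            Real.exp_log hm0]
      _ ≤ Real.exp (k * Real.log (ρ * r)) := by
          refine Real.exp_le_exp.mpr ?_
          calc 2 * Real.log m = C * Real.log m * Real.log (ρ * r) := by
                rw [hC_def]; field_simp
            _ ≤ _ := by gcongr
      _ = (ρ * r) ^ k := by rw [Real.exp_nat_mul, Real.exp_log (by linarith)]
  set q := p ^ (m / 2 + k) * (1 - p) ^ (m - (m / 2 + k)) with hq_def
  have hq0 : 0 < q := mul_pos (pow_pos h0 _) (pow_pos (by linarith) _)
  have hqr : q * r ^ k = p ^ (m / 2) * (1 - p) ^ (m - m / 2) := mass_mul_ratio_pow h0 hkm'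
  obtain ⟨hmid1, hmid2⟩ := middle_mass_bounds h0 h1 hs hsp m
  rw [← hqr] at hmid1 hmid2
  have hrk : 0 < r ^ k := by positivity
  have hsm : (2 : ℝ) ^ (α * m) * s ^ m = 1 := by
    rw [hs_def, ← Real.rpow_mul_natCast (by norm_num), ← Real.rpow_add (by norm_num)]
    simp
  have hT : (0 : ℝ) < 2 ^ (α * m) := by positivity
  -- Since `q * r ^ k ≥ s ^ m`, it suffices that `4 * r ^ k ≤ 2 ^ (n - α m)`; as `r ^ k` is
  -- polynomial in `m`, the growth of `n - α m` beyond `log m` provides this.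
  have hNq : 4 ≤ 2 ^ n m * q := by
    have hrle : 4 * r ^ k ≤ 2 ^ n m * s ^ m := by
      have e1 : 4 * r ^ k = Real.exp (Real.log 4 + k * Real.log r) := by
        rw [Real.exp_add, Real.exp_nat_mul, Real.exp_log hr0, Real.exp_log (by norm_num)]
      have e2 : 2 ^ n m * s ^ m = Real.exp ((n m - α * m) * Real.log 2) := by
        rw [hs_def, ← Real.rpow_mul_natCast (by norm_num), ← Real.rpow_natCast,
          ← Real.rpow_add (by norm_num), Real.rpow_def_of_pos (by norm_num)]
        ring_nf
      rw [e1, e2]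
      gcongr
      calc Real.log 4 + k * Real.log r ≤ Real.log 4 + (C * Real.log m + 1) * Real.log r := by
            gcongr
        _ ≤ (C * Real.log r + 1) * Real.log m := by linarith
        _ = (C * Real.log r + 1) / Real.log 2 * Real.log m * Real.log 2 := by field_simp
        _ ≤ _ := by gcongr
    have : 4 * r ^ k ≤ (2 ^ n m * q) * r ^ k := by
      calc _ ≤ _ := hrle
        _ ≤ 2 ^ n m * (q * r ^ k) := by gcongr
        _ = _ := by ring
    exact le_of_mul_le_mul_right this hrk
  refine ⟨two_pow_sub_one_le m (by omega), fun b σ hb => ?_⟩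
  refine le_trans ?_ (le_averageGuesswork_weight A h0 hp2 hb σ (j := m / 2 + k) (by omega)
    hq_def hNq)
  have hinv : (2 : ℝ) ^ (α * m) * r ^ k / r ≤ 1 / q := by
    rw [div_le_div_iff₀ hr0 hq0]
    calc _ = (2 : ℝ) ^ (α * m) * (q * r ^ k) := by ring
      _ ≤ (2 : ℝ) ^ (α * m) * (s ^ m * r) := by gcongr
      _ = _ := by rw [← mul_assoc, hsm]
  have hmiddle : (2 : ℝ) ^ m ≤ (m + 1) * m.choose (m / 2) := by
    exact_mod_cast two_pow_le_succ_mul_choose_middle m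
  have hchoose : ρ ^ k * 2 ^ m / (m + 1) ≤ m.choose (m / 2 + k) := by
    refine le_trans ?_ (pow_mul_choose_middle_le hρ0 hρ1.le hkm)
    rw [div_le_iff₀ (by positivity)]
    calc ρ ^ k * 2 ^ m ≤ ρ ^ k * ((m + 1) * m.choose (m / 2)) := by gcongr
      _ = _ := by ring
  have h2m : (2 : ℝ) ^ m = 2 ^ (m - 1) * 2 := by rw [← pow_succ]; congr 1; omega
  calc (2 : ℝ) ^ (α * m) = (2 : ℝ) ^ (α * m) * (r * (m + 1)) / (r * (m + 1)) := by field_simp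
    _ ≤ (2 : ℝ) ^ (α * m) * (ρ * r) ^ k / (r * (m + 1)) := by gcongr
    _ = (ρ ^ k * 2 ^ m / (m + 1)) * ((2 : ℝ) ^ (α * m) * r ^ k / r / 2) / 2 ^ (m - 1) := by
        rw [h2m, mul_pow]
        field_simp
    _ ≤ m.choose (m / 2 + k) * (1 / q / 2) / 2 ^ (m - 1) := by gcongr
    _ = _ := by rw [div_div, mul_comm q]

end Asymptotics

end KeyedHash

/-! ### Main theorem -/

theorem mainTheorem3 (α : ℝ) (hα : 1 < α) :
    (∃! p : ℝ, 0 < p ∧ p ≤ 1 / 2 ∧ 1 + binaryKL (1 / 2) p = α) ∧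
    ∀ (p₀ : ℝ), 0 < p₀ → p₀ ≤ 1 / 2 → 1 + binaryKL (1 / 2) p₀ = α →
    ∀ (n : ℕ → ℕ), Tendsto (fun m : ℕ => ((n m : ℝ) - α * m) / Real.log m) atTop atTop →
    ∀ (f : ∀ m l : ℕ, Key (n m) l ≃ HashFn (n m) l) (A A' : Allocation),
    ∃ u v : ℕ → ℕ,
      -- `u m` and `v m`: least output lengths for the uniform and for the biased key
      (∀ᶠ m : ℕ in atTop, IsLeast
        {l : ℕ | Achieves A (1 / 2) (f m l) (2 ^ (m - 1)) ((2 : ℝ) ^ (α * m))} (u m)) ∧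
      (∀ᶠ m : ℕ in atTop, IsLeast
        {l : ℕ | Achieves A' p₀ (segmented (n m) l) (2 ^ (m - 1)) ((2 : ℝ) ^ (α * m))} (v m)) ∧
      -- output length `m` suffices for the biased key
      (∀ᶠ m : ℕ in atTop,
        Achieves A' p₀ (segmented (n m) m) (2 ^ (m - 1)) ((2 : ℝ) ^ (α * m))) ∧
      -- the ratio of the key lengths
      Tendsto (fun m : ℕ => (keyLength (n m) (u m) : ℝ) / keyLength (n m) m) atTop (𝓝 α) ∧
      Tendsto (fun m : ℕ => (keyLength (n m) (u m) : ℝ) / keyLength (n m) (v m)) atTop (𝓝 α) ∧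
      -- the average guesswork grows at the rate `α` and no faster
      (∀ (b : ∀ m : ℕ, Fin (2 ^ (m - 1)) → Bin (u m))
        (σ : ∀ m : ℕ, Fin (2 ^ (m - 1)) → Equiv.Perm (Input (n m))),
        (∀ᶠ m : ℕ in atTop, IsLeastLikely (1 / 2) (b m)) →
        Tendsto (fun m : ℕ =>
          Real.logb 2 (averageGuesswork A (1 / 2) (f m (u m)) (b m) (σ m)) / m) atTop (𝓝 α)) ∧
      (Tendsto (fun m : ℕ => (n m : ℝ) / m) atTop (𝓝 α) →
        ∀ (b : ∀ m : ℕ, Fin (2 ^ (m - 1)) → Bin m)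
          (σ : ∀ m : ℕ, Fin (2 ^ (m - 1)) → Equiv.Perm (Input (n m))),
        (∀ᶠ m : ℕ in atTop, IsLeastLikely p₀ (b m)) →
        Tendsto (fun m : ℕ =>
          Real.logb 2 (averageGuesswork A' p₀ (segmented (n m) m) (b m) (σ m)) / m)
          atTop (𝓝 α)) := by
  refine ⟨existsUnique_bias hα, fun p h0 h1 hp n hn f A A' => ?_⟩
  have hU := eventually_achieves_half hα hn f A
  have hV := eventually_achieves_biased hα h0 h1 hp hn A'
  have hkl : ∀ m x y : ℕ, (keyLength (n m) x : ℝ) / keyLength (n m) y = (x : ℝ) / y := by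
    intro m x y
    unfold keyLength
    push_cast
    exact mul_div_mul_left _ _ (by positivity)
  set u : ℕ → ℕ := fun m =>
    sInf {l : ℕ | Achieves A (1 / 2) (f m l) (2 ^ (m - 1)) ((2 : ℝ) ^ (α * m))}
  set v : ℕ → ℕ := fun m =>
    sInf {l : ℕ | Achieves A' p (segmented (n m) l) (2 ^ (m - 1)) ((2 : ℝ) ^ (α * m))}
  have hu : ∀ᶠ m : ℕ in atTop, IsLeast
      {l : ℕ | Achieves A (1 / 2) (f m l) (2 ^ (m - 1)) ((2 : ℝ) ^ (α * m))} (u m) :=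
    hU.mono fun m hm => ⟨Nat.sInf_mem ⟨_, hm⟩, fun l hl => Nat.sInf_le hl⟩
  have hv : ∀ᶠ m : ℕ in atTop, IsLeast
      {l : ℕ | Achieves A' p (segmented (n m) l) (2 ^ (m - 1)) ((2 : ℝ) ^ (α * m))} (v m) :=
    hV.mono fun m hm => ⟨Nat.sInf_mem ⟨_, hm⟩, fun l hl => Nat.sInf_le hl⟩
  have hu_le : ∀ᶠ m : ℕ in atTop, (u m : ℝ) ≤ α * m + 2 := by
    filter_upwards [hU, hu] with m hm hum
    have hle : ((u m : ℕ) : ℝ) ≤ (⌈α * m⌉₊ + 1 : ℕ) := by exact_mod_cast hum.2 hm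
    have hlt := Nat.ceil_lt_add_one (show (0 : ℝ) ≤ α * m by positivity)
    push_cast at hle
    linarith
  have hu_lim : Tendsto (fun m : ℕ => (u m : ℝ) / m) atTop (𝓝 α) :=
    tendsto_of_linear_bounds (hu.mono fun m hm => Achieves.sub_one_le_of_half hm.1) hu_le
  have hv_lim : Tendsto (fun m : ℕ => (v m : ℝ) / m) atTop (𝓝 1) := by
    refine tendsto_of_linear_bounds (x := 1) (y := 0) ?_ ?_
    · filter_upwards [hv] with m hm
      -- The number of bins alone forces this bound.
      have hle : m - 1 ≤ v m := (Nat.pow_le_pow_iff_right (by norm_num)).mp hm.1.1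
      have hle' : (m : ℝ) ≤ v m + 1 := by exact_mod_cast (by omega : m ≤ v m + 1)
      linarith
    · filter_upwards [hV, hv] with m hm hvm
      have : (v m : ℝ) ≤ m := by exact_mod_cast hvm.2 hm
      linarith
  refine ⟨u, v, hu, hv, hV, by simpa only [hkl] using hu_lim, ?_, ?_, ?_⟩
  · simp only [hkl]
    have hdiv := hu_lim.div hv_lim one_ne_zero
    rw [div_one] at hdiv
    refine hdiv.congr' ?_
    filter_upwards [eventually_gt_atTop 0] with m hm
    have : (m : ℝ) ≠ 0 := by exact_mod_cast hm.ne'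
    exact div_div_div_cancel_right₀ this _ _
  · intro b σ hb
    -- `M + 2 ^ u ≤ 2 ^ (u + 1)` and `u ≤ α * m + 2` give the constant `3`.
    refine tendsto_of_linear_bounds (x := 0) (y := 3) ?_ ?_
    · filter_upwards [hu, hb] with m hm hbm
      have hle := hm.1.2 (b m) (σ m) hbm
      have := Real.logb_le_logb_of_le (b := 2) (by norm_num) (by positivity) hle
      rw [Real.logb_rpow (by norm_num) (by norm_num)] at this
      linarith
    · filter_upwards [hu, hb, hu_le] with m hm hbm hum
      have hle := hm.1.2 (b m) (σ m) hbm
      have hup := averageGuesswork_half_le A (f m (u m)) (b m) (σ m) (by positivity)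
      have hM : ((2 ^ (m - 1) : ℕ) : ℝ) ≤ 2 ^ u m := by exact_mod_cast hm.1.1
      rw [Real.logb_le_iff_le_rpow (by norm_num) (lt_of_lt_of_le (by positivity) hle)]
      calc _ ≤ (2 : ℝ) ^ ((u m : ℝ) + 1) := by
            rw [Real.rpow_add_one (by norm_num), Real.rpow_natCast]
            linarith
        _ ≤ _ := Real.rpow_le_rpow_of_exponent_le (by norm_num) (by linarith)
  · intro hnm b σ hb
    refine tendsto_of_tendsto_of_tendsto_of_le_of_le' tendsto_const_nhds hnm ?_ ?_
    · filter_upwards [hV, hb, eventually_gt_atTop 0] with m hm hbm hm0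
      have hle := hm.2 (b m) (σ m) hbm
      have := Real.logb_le_logb_of_le (b := 2) (by norm_num) (by positivity) hle
      rw [Real.logb_rpow (by norm_num) (by norm_num)] at this
      rwa [le_div_iff₀ (by exact_mod_cast hm0)]
    · filter_upwards [hV, hb] with m hm hbm
      have hle := hm.2 (b m) (σ m) hbm
      have hup := averageGuesswork_le A' h0 (by linarith) (segmented (n m) m) (b m) (σ m)
        (by positivity)
      gcongr
      rw [Real.logb_le_iff_le_rpow (by norm_num) (lt_of_lt_of_le (by positivity) hle),
        Real.rpow_natCast]
      exact hup
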